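/- Let agents $1,\dots,m$ have convex objective functions $f_i:\mathbb R^n\to\mathbb R$ and closed convex constraint sets $X_i\subseteq\mathbb R^n$, let $\alpha(k)>0$ be stepsizes, and let $x_i(0)\in X_i$ be given (deterministic) initial estimates. Let $(\xi(k))_{k\ge 0}$ be independent random elements of a measurable space $\Omega'$, defined on a probability space $(\Omega,\mathcal F,P)$, and let $\psi:(\mathbb R^n)^m\times\Omega'\to\mathbb R^{m\times m}$ be measurable. The projected multi-agent subgradient algorithm generates, with $x(k)=(x_1(k),\dots,x_m(k))$, $$A(k)=[a_{ij}(k)]=\psi(x(k),\xi(k)),\qquad v_i(k)=\sum_{j=1}^m a_{ij}(k)x_j(k),\qquad x_i(k+1)=P_{X_i}\big[v_i(k)-\alpha(k)d_i(k)\big],$$ where $P_{X_i}$ is Euclidean projection onto $X_i$ and $d_i(k)$ is a subgradient of $f_i$ at $v_i(k)$, chosen as a measurable function of $\xi(0),\dots,\xi(k)$. Put $y(k)=\frac1m\sum_{j=1}^m x_j(k)$. Assume: 1. (Bounded subgradients) there is $L>0$ such that $\|s\|\le L$ for every $i$, every $x\in\mathbb R^n$ and every $s\in\partial f_i(x)$;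 2. (Connectivity and state-dependent communication) there are a strongly connected directed graph $(\{1,\dots,m\},\mathcal E)$ and constants $\gamma>0$, $K>0$, $C>0$, $\delta\in(0,1]$ such that for all $(j,i)\in\mathcal E$, all $k\ge0$ and all $\bar x\in(\mathbb R^n)^m$, $$P\big(a_{ij}(k)\ge\gamma\mid x(k)=\bar x\big)=P\big(\psi(\bar x,\xi(k))_{ij}\ge\gamma\big)\ \ge\ \min\Big\{\delta,\frac{K}{\|\bar x_i-\bar x_j\|^C}\Big\},$$ the right-hand side being $\delta$ when $\bar x_i=\bar x_j$; 3. (Doubly stochastic weights) with probability one, $A(k)$ is doubly stochastic for all $k\ge 0$; 4. (Self confidence) with probability one, $a_{ii}(k)\ge\gamma$ for all $i$ and all $k\ge 0$, with the same $\gamma$; 5. (Identical sets) $X_i=X$ for all $i$, for one closed convex set $X$; 6. (Limiting stepsizes) $\lim_{k\to\infty}k\,\log^p(k)\,\alpha(k)=0$ for every real $p<1$. Then for every agent $i$ each $\|x_i(k)-y(k)\|$ is integrable, $$\lim_{k\to\infty}E\big[\|x_i(k)-y(k)\|\big]=0,\qquad\text{and}\qquad \liminf_{k\to\infty}\|x_i(k)-y(k)\|=0\quad\text{with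 probability one.}$$ -/

import Mathlib

open MeasureTheory ProbabilityTheory Filter Topology
open scoped BigOperators ENNReal

namespace DistSubgrad

/-- `s` is a subgradient at `x` of the (finite-valued) function `F`. -/
def IsSubgradientAt {n : ℕ} (F : EuclideanSpace ℝ (Fin n) → ℝ)
    (x s : EuclideanSpace ℝ (Fin n)) : Prop :=
  ∀ z, F x + inner ℝ s (z - x) ≤ F z

/-- `p` is a point of `X` nearest to `u`. -/
def IsNearestPoint {n : ℕ} (X : Set (EuclideanSpace ℝ (Fin n)))
    (u p : EuclideanSpace ℝ (Fin n)) : Prop :=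
  p ∈ X ∧ ∀ z ∈ X, ‖u - p‖ ≤ ‖u - z‖

/-- The Euclidean projection `P_X[u] = argmin_{z ∈ X} ‖u - z‖`. For nonempty closed convex `X` the
minimizer exists and is unique, see `projOn_spec` and `IsNearestPoint.eq_projOn`. -/
noncomputable def projOn {n : ℕ} (X : Set (EuclideanSpace ℝ (Fin n)))
    (u : EuclideanSpace ℝ (Fin n)) : EuclideanSpace ℝ (Fin n) :=
  Classical.epsilon (IsNearestPoint X u)

theorem projOn_spec {n : ℕ} {X : Set (EuclideanSpace ℝ (Fin n))} (hne : X.Nonempty)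
    (hcl : IsClosed X) (hcv : Convex ℝ X) (u : EuclideanSpace ℝ (Fin n)) :
    IsNearestPoint X u (projOn X u) := by
  apply Classical.epsilon_spec (p := IsNearestPoint X u)
  obtain ⟨p, hp, h⟩ := exists_norm_eq_iInf_of_complete_convex hne hcl.isComplete hcv u
  refine ⟨p, hp, fun z hz => ?_⟩
  rw [h]
  exact ciInf_le (f := fun w : X => ‖u - w‖) ⟨0, Set.forall_mem_range.2 fun _ => norm_nonneg _⟩
    ⟨z, hz⟩

theorem IsNearestPoint.eq_projOn {n : ℕ} {X : Set (EuclideanSpace ℝ (Fin n))}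
    (hcl : IsClosed X) (hcv : Convex ℝ X) {u p : EuclideanSpace ℝ (Fin n)}
    (hp : IsNearestPoint X u p) : p = projOn X u := by
  have hq := projOn_spec ⟨p, hp.1⟩ hcl hcv u
  have key : ∀ r, IsNearestPoint X u r → ∀ w ∈ X, inner ℝ (u - r) (w - r) ≤ 0 := by
    intro r hr
    apply (norm_eq_iInf_iff_real_inner_le_zero hcv hr.1).1
    have : Nonempty X := ⟨⟨r, hr.1⟩⟩
    exact le_antisymm (le_ciInf fun z => hr.2 z z.2)
      (ciInf_le (f := fun w : X => ‖u - w‖) ⟨0, Set.forall_mem_range.2 fun _ => norm_nonneg _⟩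
        ⟨r, hr.1⟩)
  have h1 := key p hp _ hq.1
  have h2 := key _ hq p hp.1
  set q := projOn X u
  have h3 : inner ℝ (u - q) (p - q) + inner ℝ (u - p) (q - p) = ‖p - q‖ ^ 2 := by
    have e1 : q - p = -(p - q) := by abel
    have e2 : u - q = (u - p) + (p - q) := by abel
    rw [e1, e2, inner_add_left, inner_neg_right, real_inner_self_eq_norm_sq]
    ring
  have h4 : ‖p - q‖ ^ 2 ≤ 0 := by linarith
  exact sub_eq_zero.1 (norm_eq_zero.1 (pow_eq_zero_iff two_ne_zero |>.1
    (le_antisymm h4 (sq_nonneg _))))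

/-- `v_i = ∑_j a_ij x_j`. -/
noncomputable def mix {m n : ℕ} (A : Matrix (Fin m) (Fin m) ℝ)
    (x : Fin m → EuclideanSpace ℝ (Fin n)) (i : Fin m) : EuclideanSpace ℝ (Fin n) :=
  ∑ j, A i j • x j

/-- The projected multi-agent subgradient algorithm. The states are
`x_i(0) = x₀ i` and `x_i(k+1) = P_{X_i}[v_i(k) - α(k) d_i(k)]`, where `v_i(k) = ∑_j a_ij(k) x_j(k)`
and the communication matrix is `A(k) = ψ(x(k), ξ(k))`. -/
noncomputable def state {m n : ℕ} {Ω Ω' : Type*} (X : Fin m → Set (EuclideanSpace ℝ (Fin n)))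
    (ψ : (Fin m → EuclideanSpace ℝ (Fin n)) → Ω' → Matrix (Fin m) (Fin m) ℝ) (ξ : ℕ → Ω → Ω')
    (α : ℕ → ℝ) (d : ℕ → Ω → Fin m → EuclideanSpace ℝ (Fin n))
    (x₀ : Fin m → EuclideanSpace ℝ (Fin n)) :
    ℕ → Ω → Fin m → EuclideanSpace ℝ (Fin n)
  | 0, _ => x₀
  | k + 1, ω => fun i =>
      projOn (X i) (mix (ψ (state X ψ ξ α d x₀ k ω) (ξ k ω)) (state X ψ ξ α d x₀ k ω) i
        - α k • d k ω i)

/-- The communication matrix `A(k) = ψ(x(k), ξ(k))` along the algorithm. -/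
noncomputable def commMatrix {m n : ℕ} {Ω Ω' : Type*} (X : Fin m → Set (EuclideanSpace ℝ (Fin n)))
    (ψ : (Fin m → EuclideanSpace ℝ (Fin n)) → Ω' → Matrix (Fin m) (Fin m) ℝ) (ξ : ℕ → Ω → Ω')
    (α : ℕ → ℝ) (d : ℕ → Ω → Fin m → EuclideanSpace ℝ (Fin n))
    (x₀ : Fin m → EuclideanSpace ℝ (Fin n)) (k : ℕ) (ω : Ω) : Matrix (Fin m) (Fin m) ℝ :=
  ψ (state X ψ ξ α d x₀ k ω) (ξ k ω)

/-- The average `y = (1/m) ∑_j x_j`. -/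
noncomputable def average {m n : ℕ} (x : Fin m → EuclideanSpace ℝ (Fin n)) :
    EuclideanSpace ℝ (Fin n) :=
  (m : ℝ)⁻¹ • ∑ j, x j

/-- The σ-algebra generated by `ξ(0), …, ξ(k)`. -/
def history {Ω Ω' : Type*} [MeasurableSpace Ω'] (ξ : ℕ → Ω → Ω') (k : ℕ) : MeasurableSpace Ω :=
  ⨆ r ∈ Set.Iic k, MeasurableSpace.comap (ξ r) inferInstance

/-- Bounded subgradients: one `L > 0` bounds all subgradients of all the `f_i` at all points. -/
def BoundedSubgradients {m n : ℕ} (f : Fin m → EuclideanSpace ℝ (Fin n) → ℝ) : Prop :=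
  ∃ L : ℝ, 0 < L ∧ ∀ i x s, IsSubgradientAt (f i) x s → ‖s‖ ≤ L

/-- Strong connectivity: a directed path (possibly of length zero) from every node to every
node. -/
def StronglyConn {m : ℕ} (G : Digraph (Fin m)) : Prop :=
  ∀ i j, Relation.ReflTransGen G.Adj i j

/-- `min {δ, K / t ^ C}` for `t ≥ 0`, with the convention `K / 0 = ∞`. -/
noncomputable def linkBound (δ K C t : ℝ) : ℝ :=
  if t = 0 then δ else min δ (K / t ^ C)

/-- State-dependent communication: for every edge `(j, i)`, every time `k` and every state `x`,
`P(a_ij(k) ≥ γ | x(k) = x) ≥ min {δ, K / ‖x_i - x_j‖ ^ C}`. As `A(k) = ψ(x(k), ξ(k))` with `ξ(k)`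
independent of `x(k)`, the conditional law of `A(k)` given `x(k) = x` is the law of `ψ(x, ξ(k))`. -/
def CommunicationModel {m n : ℕ} {Ω Ω' : Type*} [MeasurableSpace Ω] (P : Measure Ω)
    (ψ : (Fin m → EuclideanSpace ℝ (Fin n)) → Ω' → Matrix (Fin m) (Fin m) ℝ) (ξ : ℕ → Ω → Ω')
    (G : Digraph (Fin m)) (γ δ K C : ℝ) : Prop :=
  ∀ i j, G.Adj j i → ∀ (k : ℕ) (x : Fin m → EuclideanSpace ℝ (Fin n)),
    linkBound δ K C ‖x i - x j‖ ≤ P.real {ω | γ ≤ ψ x (ξ k ω) i j}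

/-- Limiting stepsizes: `k log^p(k) α(k) → 0` for every real `p < 1`. -/
def LimitingStepsizes (α : ℕ → ℝ) : Prop :=
  ∀ p : ℝ, p < 1 → Tendsto (fun k : ℕ => (k : ℝ) * Real.log k ^ p * α k) atTop (𝓝 0)

end DistSubgrad

/-! The Lyapunov function is the sum `V` of squared pairwise distances. Averaging with a doubly
stochastic matrix lowers `V` by at least a constant times the squared lengths of the active links
(`disagreement_mix_le`), and strong connectivity bounds `V` by the squared lengths along all edges
(`StronglyConn.exists_disagreement_le`). Since `x(k)` depends only on the noise before time `k`, it
is independent of `ξ(k)`: if every edge is active with conditional probability at least `p`,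
averaging multiplies `E V` by at most `1 - θp` (`integral_disagreement_mix_le`).

The link probabilities may decay, but not fast. Averaging does not increase the diameter and each
subgradient step adds at most `2Lα(k)` to it. As `α(k) = O(1/k)`, the diameter is almost surely
`O(log k)`, hence below a multiple of `(k+1)^(1/(2C))`, and `p` can be taken of order `1/√(k+1)`.

With `q(k)` of that order, absorbing the subgradient step by Young's inequality gives `E V(k+1) ≤ (1
- q/2) E V(k) + (q/2) O((α/q)²)`. Here `∑ q` diverges and `α/q = O(1/√k)`, so `E V → 0`. Jensen's
inequality turns this into convergence of the expected distance to the average, and Fatou's lemma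
gives the almost sure liminf. -/

namespace DistSubgrad

/-! ### Algebra of the disagreement function -/

/-- The total squared disagreement of a family of vectors. -/
noncomputable def disagreement {m n : ℕ} (x : Fin m → EuclideanSpace ℝ (Fin n)) : ℝ :=
  ∑ i, ∑ j, ‖x i - x j‖ ^ 2

theorem disagreement_nonneg {m n : ℕ} (x : Fin m → EuclideanSpace ℝ (Fin n)) :
    0 ≤ disagreement x := by
  unfold disagreement; positivity

/-- The weighted variance identity, for unnormalised weights. Unit weights yield `disagreement_eq`;
the rows of a stochastic matrix yield the variance lost in averaging. -/
theorem sum_weighted_dist_sq {m n : ℕ} (w : Fin m → ℝ) (x : Fin m → EuclideanSpace ℝ (Fin n)) :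
    ∑ i, ∑ j, w i * w j * ‖x i - x j‖ ^ 2
      = 2 * (∑ i, w i) * (∑ i, w i * ‖x i‖ ^ 2) - 2 * ‖∑ i, w i • x i‖ ^ 2 := by
  have h : ‖∑ i, w i • x i‖ ^ 2 = ∑ i, ∑ j, w i * w j * inner ℝ (x i) (x j) := by
    rw [← real_inner_self_eq_norm_sq, sum_inner]
    refine Finset.sum_congr rfl fun i _ => ?_
    rw [inner_sum]
    refine Finset.sum_congr rfl fun j _ => ?_
    rw [real_inner_smul_left, real_inner_smul_right, mul_assoc]
  have h1 : (∑ i, w i) * (∑ i, w i * ‖x i‖ ^ 2) = ∑ i, ∑ j, w i * w j * ‖x j‖ ^ 2 := by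
    rw [Finset.sum_mul_sum]
    simp only [mul_assoc]
  have h2 : (∑ i, w i) * (∑ i, w i * ‖x i‖ ^ 2) = ∑ i, ∑ j, w i * w j * ‖x i‖ ^ 2 := by
    rw [h1, Finset.sum_comm]
    refine Finset.sum_congr rfl fun i _ => Finset.sum_congr rfl fun j _ => by ring
  calc ∑ i, ∑ j, w i * w j * ‖x i - x j‖ ^ 2
      = ∑ i, ∑ j, w i * w j * ‖x i‖ ^ 2 + ∑ i, ∑ j, w i * w j * ‖x j‖ ^ 2
          - 2 * ∑ i, ∑ j, w i * w j * inner ℝ (x i) (x j) := by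
        simp only [Finset.mul_sum, ← Finset.sum_add_distrib, ← Finset.sum_sub_distrib]
        refine Finset.sum_congr rfl fun i _ => Finset.sum_congr rfl fun j _ => ?_
        rw [norm_sub_sq_real]; ring
    _ = _ := by rw [← h1, ← h2, ← h]; ring

theorem disagreement_eq {m n : ℕ} (x : Fin m → EuclideanSpace ℝ (Fin n)) :
    disagreement x = 2 * m * (∑ i, ‖x i‖ ^ 2) - 2 * ‖∑ i, x i‖ ^ 2 := by
  simpa [disagreement] using sum_weighted_dist_sq (fun _ => 1) x

theorem norm_sub_average_sq_le {m n : ℕ} (x : Fin m → EuclideanSpace ℝ (Fin n)) (i : Fin m) :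
    ‖x i - average x‖ ^ 2 ≤ disagreement x := by
  have hm : (1 : ℝ) ≤ m := by exact_mod_cast i.pos
  have h : x i - average x = (m : ℝ)⁻¹ • ∑ j, (x i - x j) := by
    have : (m : ℝ) ≠ 0 := by positivity
    simp only [average, Finset.sum_sub_distrib, Finset.sum_const, Finset.card_univ,
      Fintype.card_fin, smul_sub, ← Nat.cast_smul_eq_nsmul ℝ, smul_smul]
    rw [inv_mul_cancel₀ this, one_smul]
  have h1 : ‖∑ j, (x i - x j)‖ ^ 2 ≤ m * ∑ j, ‖x i - x j‖ ^ 2 := by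
    calc ‖∑ j, (x i - x j)‖ ^ 2 ≤ (∑ j, ‖x i - x j‖) ^ 2 := by
          gcongr; exact norm_sum_le _ _
      _ ≤ m * ∑ j, ‖x i - x j‖ ^ 2 := by
          simpa using sq_sum_le_card_mul_sum_sq (s := Finset.univ) (f := fun j => ‖x i - x j‖)
  have h2 : ∑ j, ‖x i - x j‖ ^ 2 ≤ disagreement x :=
    Finset.single_le_sum (f := fun i => ∑ j, ‖x i - x j‖ ^ 2)
      (fun _ _ => by positivity) (Finset.mem_univ i)
  rw [h, norm_smul, mul_pow, norm_inv, Real.norm_natCast]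
  calc ((m : ℝ)⁻¹) ^ 2 * ‖∑ j, (x i - x j)‖ ^ 2
      ≤ ((m : ℝ)⁻¹) ^ 2 * (m * disagreement x) := by gcongr; exact h1.trans (by gcongr)
    _ = (m : ℝ)⁻¹ * disagreement x := by field_simp
    _ ≤ 1 * disagreement x := by
        gcongr
        · exact disagreement_nonneg x
        · exact inv_le_one_of_one_le₀ hm
    _ = _ := one_mul _

theorem disagreement_le_of_dist_le {m n : ℕ} {x : Fin m → EuclideanSpace ℝ (Fin n)} {D : ℝ}
    (h : ∀ i j, ‖x i - x j‖ ≤ D) : disagreement x ≤ m ^ 2 * D ^ 2 := by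
  calc disagreement x ≤ ∑ _i : Fin m, ∑ _j : Fin m, D ^ 2 := by
        unfold disagreement; gcongr with i _ j _; exact h i j
    _ = _ := by simp; ring

/-- Young's inequality on the cross term. The parameter `η` stays free so that it can later be tuned
to half the contraction rate. -/
theorem disagreement_perturb_le {m n : ℕ} {x v : Fin m → EuclideanSpace ℝ (Fin n)} {b η : ℝ}
    (hη : 0 < η) (h : ∀ i, ‖x i - v i‖ ≤ b) :
    disagreement x ≤ (1 + η) * disagreement v + (1 + η⁻¹) * (4 * m ^ 2 * b ^ 2) := by
  have key : ∀ i j, ‖x i - x j‖ ^ 2 ≤ (1 + η) * ‖v i - v j‖ ^ 2 + (1 + η⁻¹) * (4 * b ^ 2) := by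
    intro i j
    have h1 : ‖x i - x j‖ ≤ ‖v i - v j‖ + 2 * b := by
      have e : x i - x j = (v i - v j) + ((x i - v i) - (x j - v j)) := by abel
      rw [e]
      refine (norm_add_le _ _).trans ?_
      have := norm_sub_le (x i - v i) (x j - v j)
      linarith [h i, h j]
    have h2 : 2 * (‖v i - v j‖ * (2 * b)) ≤ η * ‖v i - v j‖ ^ 2 + η⁻¹ * (2 * b) ^ 2 := by
      have e : η * ‖v i - v j‖ ^ 2 + η⁻¹ * (2 * b) ^ 2 - 2 * (‖v i - v j‖ * (2 * b))
          = η⁻¹ * (η * ‖v i - v j‖ - 2 * b) ^ 2 := by field_simp; ring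
      have : 0 ≤ η⁻¹ * (η * ‖v i - v j‖ - 2 * b) ^ 2 := by positivity
      linarith
    have h3 : ‖x i - x j‖ ^ 2 ≤ (‖v i - v j‖ + 2 * b) ^ 2 := by gcongr
    nlinarith
  calc disagreement x
      ≤ ∑ i, ∑ j, ((1 + η) * ‖v i - v j‖ ^ 2 + (1 + η⁻¹) * (4 * b ^ 2)) := by
        unfold disagreement; gcongr with i _ j _; exact key i j
    _ = _ := by
        simp only [Finset.sum_add_distrib, ← Finset.mul_sum, disagreement, Finset.sum_const,
          Finset.card_univ, Fintype.card_fin, nsmul_eq_mul]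
        ring

/-! ### Averaging, connectivity and projection -/

open Classical in
/-- One step of averaging with a doubly stochastic matrix decreases the disagreement by an amount
controlled by the active links. -/
theorem disagreement_mix_le {m n : ℕ} {A : Matrix (Fin m) (Fin m) ℝ}
    (hA : A ∈ doublyStochastic ℝ (Fin m)) {γ : ℝ} (hγ : 0 < γ) (hdiag : ∀ i, γ ≤ A i i)
    (G : Digraph (Fin m)) (x : Fin m → EuclideanSpace ℝ (Fin n)) :
    disagreement (mix A x) ≤ disagreement x
      - m * γ ^ 2 * ∑ i, ∑ j, if G.Adj j i ∧ γ ≤ A i j then ‖x i - x j‖ ^ 2 else 0 := by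
  obtain ⟨hnn, hrow, hcol⟩ := mem_doublyStochastic_iff_sum.1 hA
  have hsum : ∑ i, mix A x i = ∑ i, x i := by
    simp only [mix]
    rw [Finset.sum_comm]
    refine Finset.sum_congr rfl fun j _ => ?_
    rw [← Finset.sum_smul, hcol, one_smul]
  -- Row sums equal to one give the variance identity for each row; column sums equal to one make
  -- the leading terms add up to `∑ ‖x i‖ ^ 2`.
  have hsq : ∑ i, ‖mix A x i‖ ^ 2
      = ∑ i, ‖x i‖ ^ 2 - (1 / 2) * ∑ i, ∑ j, ∑ l, A i j * A i l * ‖x j - x l‖ ^ 2 := by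
    have h1 : ∀ i, ‖mix A x i‖ ^ 2 = ∑ j, A i j * ‖x j‖ ^ 2
        - (1 / 2) * ∑ j, ∑ l, A i j * A i l * ‖x j - x l‖ ^ 2 := by
      intro i
      have := sum_weighted_dist_sq (A i) x
      rw [hrow, ← mix] at this
      linarith
    simp only [h1, Finset.sum_sub_distrib, ← Finset.mul_sum]
    congr 1
    rw [Finset.sum_comm]
    refine Finset.sum_congr rfl fun j _ => ?_
    rw [← Finset.sum_mul, hcol, one_mul]
  have hlow : γ ^ 2 * (∑ i, ∑ j, if G.Adj j i ∧ γ ≤ A i j then ‖x i - x j‖ ^ 2 else 0)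
      ≤ ∑ i, ∑ j, ∑ l, A i j * A i l * ‖x j - x l‖ ^ 2 := by
    rw [Finset.mul_sum]
    refine Finset.sum_le_sum fun i _ => ?_
    -- Only the pairs containing `i` itself are kept: self confidence and an active link `(l, i)`
    -- make the coefficient `A i i * A i l` at least `γ ^ 2`.
    have hs : ∑ l, A i i * A i l * ‖x i - x l‖ ^ 2
        ≤ ∑ j, ∑ l, A i j * A i l * ‖x j - x l‖ ^ 2 := by
      refine Finset.single_le_sum (f := fun j => ∑ l, A i j * A i l * ‖x j - x l‖ ^ 2)
        (fun j _ => Finset.sum_nonneg fun l _ => ?_) (Finset.mem_univ i)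
      exact mul_nonneg (mul_nonneg (hnn i j) (hnn i l)) (sq_nonneg _)
    refine le_trans ?_ hs
    rw [Finset.mul_sum]
    refine Finset.sum_le_sum fun j _ => ?_
    split_ifs with h
    · have := mul_le_mul (hdiag i) h.2 hγ.le (hnn i i)
      rw [sq γ]
      gcongr
    · rw [mul_zero]
      exact mul_nonneg (mul_nonneg (hnn i i) (hnn i j)) (sq_nonneg _)
  rw [disagreement_eq, disagreement_eq, hsum, hsq]
  have := mul_le_mul_of_nonneg_left hlow (Nat.cast_nonneg (α := ℝ) m)
  linarith

open Classical in
/-- Over a strongly connected graph the disagreement is controlled by that along the edges. -/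
theorem StronglyConn.exists_disagreement_le {m : ℕ} {G : Digraph (Fin m)} (hG : StronglyConn G)
    (n : ℕ) :
    ∃ c : ℝ, 0 ≤ c ∧ ∀ x : Fin m → EuclideanSpace ℝ (Fin n),
      disagreement x ≤ c * ∑ i, ∑ j, if G.Adj j i then ‖x i - x j‖ ^ 2 else 0 := by
  have key : ∀ i j, ∃ c : ℝ, 0 ≤ c ∧ ∀ x : Fin m → EuclideanSpace ℝ (Fin n),
      ‖x i - x j‖ ^ 2 ≤ c * ∑ i, ∑ j, if G.Adj j i then ‖x i - x j‖ ^ 2 else 0 := by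
    intro i j
    induction hG i j with
    | refl => exact ⟨0, le_rfl, fun x => by simp⟩
    | @tail k l _ hkl ih =>
      obtain ⟨c, hc, h⟩ := ih
      -- From `(a + b)² ≤ 2a² + 2b²`: the path so far costs `2c` and the new edge costs `2`.
      refine ⟨2 * c + 2, by positivity, fun x => ?_⟩
      have h1 : ‖x l - x k‖ ^ 2 ≤ ∑ i, ∑ j, if G.Adj j i then ‖x i - x j‖ ^ 2 else 0 := by
        have a1 : ‖x l - x k‖ ^ 2 ≤ ∑ j, if G.Adj j l then ‖x l - x j‖ ^ 2 else 0 := by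
          have := Finset.single_le_sum (f := fun j => if G.Adj j l then ‖x l - x j‖ ^ 2 else 0)
            (fun j _ => by split_ifs <;> positivity) (Finset.mem_univ k)
          simpa [hkl] using this
        refine a1.trans ?_
        exact Finset.single_le_sum
          (f := fun i => ∑ j, if G.Adj j i then ‖x i - x j‖ ^ 2 else 0)
          (fun i _ => Finset.sum_nonneg fun j _ => by split_ifs <;> positivity)
          (Finset.mem_univ l)
      have h2 : ‖x i - x l‖ ≤ ‖x i - x k‖ + ‖x l - x k‖ := by
        rw [norm_sub_rev (x l)]; exact norm_sub_le_norm_sub_add_norm_sub _ _ _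
      have h3 : ‖x i - x l‖ ^ 2 ≤ (‖x i - x k‖ + ‖x l - x k‖) ^ 2 := by gcongr
      nlinarith [h x, sq_nonneg (‖x i - x k‖ - ‖x l - x k‖)]
  choose c hc h using key
  refine ⟨∑ i, ∑ j, c i j, Finset.sum_nonneg fun i _ => Finset.sum_nonneg fun j _ => hc i j,
    fun x => ?_⟩
  rw [Finset.sum_mul]
  refine Finset.sum_le_sum fun i _ => ?_
  rw [Finset.sum_mul]
  exact Finset.sum_le_sum fun j _ => h i j x

theorem mix_mem_of_convex {m n : ℕ} {A : Matrix (Fin m) (Fin m) ℝ}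
    (hA : A ∈ doublyStochastic ℝ (Fin m)) {S : Set (EuclideanSpace ℝ (Fin n))} (hS : Convex ℝ S)
    {x : Fin m → EuclideanSpace ℝ (Fin n)} (hx : ∀ i, x i ∈ S) (i : Fin m) : mix A x i ∈ S := by
  obtain ⟨hnn, hrow, -⟩ := mem_doublyStochastic_iff_sum.1 hA
  exact hS.sum_mem (fun j _ => hnn i j) (hrow i) fun j _ => hx j

/-- Convexity of balls, used twice: `mix A x i` is within `D` of every `x l`, so the ball of radius
`D` about it contains every `x l` and therefore `mix A x j`. -/
theorem norm_mix_sub_mix_le {m n : ℕ} {A : Matrix (Fin m) (Fin m) ℝ}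
    (hA : A ∈ doublyStochastic ℝ (Fin m)) {x : Fin m → EuclideanSpace ℝ (Fin n)} {D : ℝ}
    (h : ∀ i j, ‖x i - x j‖ ≤ D) (i j : Fin m) : ‖mix A x i - mix A x j‖ ≤ D := by
  have h1 : ∀ l, mix A x i ∈ Metric.closedBall (x l) D := fun l =>
    mix_mem_of_convex hA (convex_closedBall _ _) (fun i => by
      rw [mem_closedBall_iff_norm]; exact h i l) i
  have h2 : mix A x j ∈ Metric.closedBall (mix A x i) D :=
    mix_mem_of_convex hA (convex_closedBall _ _) (fun l => by
      rw [Metric.mem_closedBall_comm]; exact h1 l) j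
  rwa [Metric.mem_closedBall_comm, mem_closedBall_iff_norm] at h2

theorem IsNearestPoint.inner_le_zero {n : ℕ} {X : Set (EuclideanSpace ℝ (Fin n))}
    (hcv : Convex ℝ X) {u p : EuclideanSpace ℝ (Fin n)} (hp : IsNearestPoint X u p) :
    ∀ w ∈ X, inner ℝ (u - p) (w - p) ≤ 0 := by
  apply (norm_eq_iInf_iff_real_inner_le_zero hcv hp.1).1
  have : Nonempty X := ⟨⟨p, hp.1⟩⟩
  exact le_antisymm (le_ciInf fun z => hp.2 z z.2)
    (ciInf_le (f := fun w : X => ‖u - w‖) ⟨0, Set.forall_mem_range.2 fun _ => norm_nonneg _⟩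
      ⟨p, hp.1⟩)

/-- Adding the variational inequalities at the two projections `p`, `q` gives `‖p - q‖² ≤ ⟪u - w, p
- q⟫`; Cauchy–Schwarz finishes. -/
theorem lipschitzWith_projOn {n : ℕ} {X : Set (EuclideanSpace ℝ (Fin n))} (hne : X.Nonempty)
    (hcl : IsClosed X) (hcv : Convex ℝ X) : LipschitzWith 1 (projOn X) := by
  refine LipschitzWith.of_dist_le_mul fun u w => ?_
  have hu := projOn_spec hne hcl hcv u
  have hw := projOn_spec hne hcl hcv w
  have h1 := hu.inner_le_zero hcv _ hw.1
  have h2 := hw.inner_le_zero hcv _ hu.1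
  rw [NNReal.coe_one, one_mul, dist_eq_norm, dist_eq_norm]
  set p := projOn X u
  set q := projOn X w
  have h3 : inner ℝ (u - p) (q - p) + inner ℝ (w - q) (p - q)
      = ‖p - q‖ ^ 2 - inner ℝ (u - w) (p - q) := by
    have e1 : q - p = -(p - q) := by abel
    have e2 : u - p = (u - w) + (w - q) - (p - q) := by abel
    rw [e1, e2, inner_neg_right, inner_sub_left, inner_add_left, real_inner_self_eq_norm_sq]
    ring
  have h4 := real_inner_le_norm (u - w) (p - q)
  rcases (norm_nonneg (p - q)).eq_or_lt with h | h
  · rw [← h]; exact norm_nonneg _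
  · nlinarith

theorem norm_projOn_sub_le {n : ℕ} {X : Set (EuclideanSpace ℝ (Fin n))} (hcl : IsClosed X)
    (hcv : Convex ℝ X) {v : EuclideanSpace ℝ (Fin n)} (hv : v ∈ X)
    (u : EuclideanSpace ℝ (Fin n)) : ‖projOn X u - v‖ ≤ ‖u - v‖ := by
  have hpv : v = projOn X v := IsNearestPoint.eq_projOn hcl hcv ⟨hv, fun z _ => by simp⟩
  have := (lipschitzWith_projOn ⟨v, hv⟩ hcl hcv).dist_le_mul u v
  rwa [← hpv, NNReal.coe_one, one_mul, dist_eq_norm, dist_eq_norm] at this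

/-! ### Real sequences: stepsizes, link bounds and contraction -/

/-- The sum is at most `M` times a harmonic number, hence logarithmic, and the logarithm is
dominated by every positive power. -/
theorem exists_rpow_bound_of_sum {α : ℕ → ℝ} {M : ℝ} (hM : 0 ≤ M)
    (hα : ∀ k : ℕ, α k ≤ M / (k + 1)) {s : ℝ} (hs : 0 < s) :
    ∃ B : ℝ, 0 ≤ B ∧ ∀ k : ℕ, ∑ r ∈ Finset.range k, α r ≤ B * ((k : ℝ) + 1) ^ s := by
  refine ⟨M * (1 + 1 / s), by positivity, fun k => ?_⟩
  have h1 : ∑ r ∈ Finset.range k, α r ≤ M * (harmonic k : ℝ) := by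
    simp only [harmonic, Rat.cast_sum, Finset.mul_sum]
    refine Finset.sum_le_sum fun r _ => (hα r).trans_eq ?_
    push_cast
    rw [div_eq_mul_inv]
  have h2 : (1 : ℝ) ≤ ((k : ℝ) + 1) ^ s :=
    Real.one_le_rpow (by linarith [Nat.cast_nonneg (α := ℝ) k]) hs.le
  have h3 : (harmonic k : ℝ) ≤ 1 + ((k : ℝ) + 1) ^ s / s := by
    refine (harmonic_le_one_add_log k).trans ?_
    gcongr
    refine (Real.log_le_rpow_div (Nat.cast_nonneg k) hs).trans ?_
    gcongr
    linarith
  calc _ ≤ M * (harmonic k : ℝ) := h1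
    _ ≤ M * (((k : ℝ) + 1) ^ s + ((k : ℝ) + 1) ^ s / s) := by gcongr; linarith
    _ = _ := by ring

theorem LimitingStepsizes.exists_le_div {α : ℕ → ℝ} (h : LimitingStepsizes α) :
    ∃ M : ℝ, 0 ≤ M ∧ ∀ k : ℕ, α k ≤ M / (k + 1) := by
  have h0 : Tendsto (fun k : ℕ => (k : ℝ) * α k) atTop (𝓝 0) := by
    simpa using h 0 one_pos
  obtain ⟨M, hM⟩ := h0.bddAbove_range
  -- The term `|α 0|` covers `k = 0`; for `k ≥ 1` both `k * α k` and `α k` are at most `|M|`.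
  refine ⟨|α 0| + 2 * |M|, by positivity, fun k => ?_⟩
  have hk : (k : ℝ) * α k ≤ |M| := (hM ⟨k, rfl⟩).trans (le_abs_self M)
  rw [le_div_iff₀ (by positivity)]
  rcases Nat.eq_zero_or_pos k with rfl | hpos
  · simp only [Nat.cast_zero, zero_add, mul_one]
    linarith [le_abs_self (α 0), abs_nonneg M]
  · have hk1 : (1 : ℝ) ≤ k := by exact_mod_cast hpos
    have : α k ≤ |M| := by
      rcases le_total (α k) 0 with h' | h'
      · exact h'.trans (abs_nonneg M)
      · nlinarith
    linarith [abs_nonneg (α 0)]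

/-- If the distances grow slowly enough, then link probabilities decay at most like
`1 / √(k + 1)`. -/
theorem exists_le_linkBound {δ K C : ℝ} (hδ : 0 < δ) (hδ1 : δ ≤ 1) (hK : 0 < K) (hC : 0 < C)
    {B : ℝ} (hB : 0 < B) :
    ∃ c : ℝ, 0 < c ∧ c ≤ 1 ∧ ∀ (k : ℕ) (t : ℝ), 0 ≤ t →
      t ≤ B * ((k : ℝ) + 1) ^ (1 / (2 * C)) → c / √((k : ℝ) + 1) ≤ linkBound δ K C t := by
  refine ⟨min δ (K / B ^ C), by positivity, (min_le_left _ _).trans hδ1, fun k t ht htB => ?_⟩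
  have h1 : 1 ≤ √((k : ℝ) + 1) := by
    rw [Real.one_le_sqrt]; linarith [Nat.cast_nonneg (α := ℝ) k]
  have h2 : min δ (K / B ^ C) / √((k : ℝ) + 1) ≤ δ :=
    (div_le_self (by positivity) h1).trans (min_le_left _ _)
  unfold linkBound
  split_ifs with h
  · exact h2
  · refine le_min h2 ?_
    have ht' : 0 < t := lt_of_le_of_ne ht (Ne.symm h)
    -- The exponent `1 / (2 * C)` is chosen so that raising to the power `C` leaves exactly a square
    -- root.
    have h3 : t ^ C ≤ B ^ C * √((k : ℝ) + 1) := by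
      calc t ^ C ≤ (B * ((k : ℝ) + 1) ^ (1 / (2 * C))) ^ C := by gcongr
        _ = _ := by
          rw [Real.mul_rpow hB.le (by positivity), ← Real.rpow_mul (by positivity),
            Real.sqrt_eq_rpow]
          congr 2
          field_simp
    calc min δ (K / B ^ C) / √((k : ℝ) + 1) ≤ (K / B ^ C) / √((k : ℝ) + 1) := by
          gcongr; exact min_le_right _ _
      _ = K / (B ^ C * √((k : ℝ) + 1)) := by rw [div_div]
      _ ≤ K / t ^ C := by gcongr

/-- A perturbed contraction with non-summable contraction rates tends to zero. -/
theorem tendsto_zero_of_perturbed_contraction {u q b : ℕ → ℝ} (hu : ∀ k, 0 ≤ u k)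
    (hq : ∀ k, q k ≤ 1) (hq0 : ∀ k, 0 ≤ q k)
    (hqsum : Tendsto (fun k => ∑ r ∈ Finset.range k, q r) atTop atTop)
    (hb : Tendsto b atTop (𝓝 0)) (h : ∀ k, u (k + 1) ≤ (1 - q k) * u k + q k * b k) :
    Tendsto u atTop (𝓝 0) := by
  rw [Metric.tendsto_atTop]
  intro ε hε
  obtain ⟨N, hN⟩ := eventually_atTop.1 (hb.eventually (gt_mem_nhds (half_pos hε)))
  -- Once `b ≤ ε / 2`, the excess `u - ε / 2` is multiplied by at most `1 - q ≤ exp (-q)` at each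
  -- step.
  have key : ∀ k, u (N + k) - ε / 2
      ≤ u N * Real.exp (-(∑ r ∈ Finset.range (N + k), q r - ∑ r ∈ Finset.range N, q r)) := by
    intro k
    induction k with
    | zero => simp; linarith
    | succ k ih =>
      have h1 : u (N + (k + 1)) - ε / 2 ≤ (1 - q (N + k)) * (u (N + k) - ε / 2) := by
        have := h (N + k)
        have h2 := mul_le_mul_of_nonneg_left (hN (N + k) (by omega)).le (hq0 (N + k))
        rw [← add_assoc]
        linarith
      refine h1.trans ?_
      refine (mul_le_mul_of_nonneg_left ih (sub_nonneg.2 (hq (N + k)))).trans ?_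
      rw [← add_assoc, Finset.sum_range_succ]
      have h3 : 1 - q (N + k) ≤ Real.exp (-q (N + k)) := by
        have := Real.add_one_le_exp (-q (N + k)); linarith
      have e : -(∑ r ∈ Finset.range (N + k), q r + q (N + k) - ∑ r ∈ Finset.range N, q r)
          = -q (N + k) + -(∑ r ∈ Finset.range (N + k), q r - ∑ r ∈ Finset.range N, q r) := by
        ring
      rw [e, Real.exp_add, mul_left_comm]
      exact mul_le_mul_of_nonneg_left
        (mul_le_mul_of_nonneg_right h3 (Real.exp_pos _).le) (hu N)
  have hlim : Tendsto (fun k => u N *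
      Real.exp (-(∑ r ∈ Finset.range k, q r - ∑ r ∈ Finset.range N, q r))) atTop (𝓝 0) := by
    have := (Real.tendsto_exp_neg_atTop_nhds_zero.comp
      (tendsto_atTop_add_const_right atTop (-∑ r ∈ Finset.range N, q r) hqsum)).const_mul (u N)
    simpa [sub_eq_add_neg] using this
  obtain ⟨N', hN'⟩ := eventually_atTop.1 (hlim.eventually (gt_mem_nhds (half_pos hε)))
  refine ⟨max N N', fun k hk => ?_⟩
  obtain ⟨l, rfl⟩ := Nat.exists_eq_add_of_le ((le_max_left N N').trans hk)
  have h1 := key l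
  have h2 := hN' (N + l) ((le_max_right N N').trans hk)
  rw [Real.dist_eq, sub_zero, abs_of_nonneg (hu _)]
  linarith

theorem tendsto_sum_const_div_sqrt {c : ℝ} (hc : 0 < c) :
    Tendsto (fun k => ∑ r ∈ Finset.range k, c / √((r : ℝ) + 1)) atTop atTop := by
  have h := (Real.tendsto_sum_range_one_div_nat_succ_atTop).const_mul_atTop hc
  refine tendsto_atTop_mono (fun k => ?_) h
  rw [Finset.mul_sum]
  refine Finset.sum_le_sum fun r _ => ?_
  rw [mul_one_div]
  have h1 : (1 : ℝ) ≤ (r : ℝ) + 1 := by linarith [Nat.cast_nonneg (α := ℝ) r]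
  gcongr
  exact Real.sqrt_le_iff.2 ⟨by linarith, by nlinarith⟩

/-! ### Measurability, independence and expected contraction -/

theorem measurable_disagreement {m n : ℕ} :
    Measurable (disagreement : (Fin m → EuclideanSpace ℝ (Fin n)) → ℝ) := by
  unfold disagreement; fun_prop

theorem measurable_mix {m n : ℕ} {Ω Ω' : Type*} {_ : MeasurableSpace Ω} [MeasurableSpace Ω']
    {ψ : (Fin m → EuclideanSpace ℝ (Fin n)) → Ω' → Matrix (Fin m) (Fin m) ℝ}
    (hψ : ∀ i j, Measurable fun p : (Fin m → EuclideanSpace ℝ (Fin n)) × Ω' => ψ p.1 p.2 i j)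
    {x : Ω → Fin m → EuclideanSpace ℝ (Fin n)} (hx : Measurable x) {ξ : Ω → Ω'}
    (hξ : Measurable ξ) : Measurable fun ω => mix (ψ (x ω) (ξ ω)) (x ω) := by
  refine measurable_pi_iff.2 fun i => ?_
  unfold mix
  refine Finset.measurable_fun_sum _ fun j _ => ?_
  have h1 : Measurable fun ω => ψ (x ω) (ξ ω) i j := (hψ i j).comp (hx.prodMk hξ)
  exact h1.smul (measurable_pi_iff.1 hx j)

/-- The σ-algebra generated by `ξ(0), …, ξ(k-1)`. -/
@[reducible]
def past {Ω Ω' : Type*} [MeasurableSpace Ω'] (ξ : ℕ → Ω → Ω') (k : ℕ) : MeasurableSpace Ω :=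
  ⨆ r ∈ Set.Iio k, MeasurableSpace.comap (ξ r) inferInstance

theorem past_succ {Ω Ω' : Type*} [MeasurableSpace Ω'] (ξ : ℕ → Ω → Ω') (k : ℕ) :
    past ξ (k + 1) = history ξ k := by
  unfold past history
  congr! 3 with r
  simp

theorem past_mono {Ω Ω' : Type*} [MeasurableSpace Ω'] (ξ : ℕ → Ω → Ω') {k l : ℕ} (h : k ≤ l) :
    past ξ k ≤ past ξ l :=
  biSup_mono fun _ hr => lt_of_lt_of_le hr h

theorem past_le {Ω Ω' : Type*} [mΩ : MeasurableSpace Ω] [MeasurableSpace Ω'] {ξ : ℕ → Ω → Ω'}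
    (hξ : ∀ k, Measurable (ξ k)) (k : ℕ) : past ξ k ≤ mΩ :=
  iSup₂_le fun r _ => (hξ r).comap_le

/-- The strict past is what matters: `x(k)` does not involve `ξ(k)`, although `d(k)` may. This makes
`x(k)` independent of the noise that selects `A(k)`. -/
theorem measurable_state {m n : ℕ} {Ω Ω' : Type*} [MeasurableSpace Ω']
    {X : Fin m → Set (EuclideanSpace ℝ (Fin n))} (hne : ∀ i, (X i).Nonempty)
    (hcl : ∀ i, IsClosed (X i)) (hcv : ∀ i, Convex ℝ (X i))
    {ψ : (Fin m → EuclideanSpace ℝ (Fin n)) → Ω' → Matrix (Fin m) (Fin m) ℝ}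
    (hψ : ∀ i j, Measurable fun p : (Fin m → EuclideanSpace ℝ (Fin n)) × Ω' => ψ p.1 p.2 i j)
    (ξ : ℕ → Ω → Ω') (α : ℕ → ℝ) {d : ℕ → Ω → Fin m → EuclideanSpace ℝ (Fin n)}
    (hd : ∀ k i, Measurable[history ξ k] fun ω => d k ω i)
    (x₀ : Fin m → EuclideanSpace ℝ (Fin n)) (k : ℕ) :
    Measurable[past ξ k] (state X ψ ξ α d x₀ k) := by
  induction k with
  | zero => exact @measurable_const _ _ _ (past ξ 0) x₀
  | succ k ih =>
    have hx := ih.mono (past_mono ξ k.le_succ) le_rfl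
    have hξ : Measurable[past ξ (k + 1)] (ξ k) :=
      (comap_measurable (ξ k)).mono (le_iSup₂_of_le k k.lt_succ_self le_rfl) le_rfl
    have hd' := hd k
    rw [← past_succ] at hd'
    refine @measurable_pi_iff _ _ _ (past ξ (k + 1)) _ _ |>.2 fun i => ?_
    have hmix := @measurable_pi_iff _ _ _ (past ξ (k + 1)) _ _ |>.1
      (@measurable_mix m n Ω Ω' (past ξ (k + 1)) _ ψ hψ _ hx _ hξ) i
    exact (lipschitzWith_projOn (hne i) (hcl i) (hcv i)).continuous.measurable.comp
      (hmix.sub ((hd' i).const_smul (α k)))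

theorem indepFun_of_measurable_past {Ω Ω' β : Type*} [MeasurableSpace Ω] [MeasurableSpace Ω']
    [MeasurableSpace β] {P : Measure Ω} {ξ : ℕ → Ω → Ω'} (hξ : ∀ k, Measurable (ξ k))
    (hindep : iIndepFun ξ P) {k : ℕ} {x : Ω → β} (hx : Measurable[past ξ k] x) :
    IndepFun x (ξ k) P := by
  rw [IndepFun_iff_Indep]
  have h := indep_iSup_of_disjoint (fun r => (hξ r).comap_le) hindep
    (S := Set.Iio k) (T := {k}) (by simp)
  refine indep_of_indep_of_le_left (indep_of_indep_of_le_right h ?_) hx.comap_le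
  exact le_iSup₂_of_le (f := fun r (_ : r ∈ ({k} : Set ℕ)) =>
    MeasurableSpace.comap (ξ r) inferInstance) k rfl le_rfl

/-- If every section of `T` over the values of `x` has probability at least `p`, then restricting
the integral of `g(x)` to `(x, ξ) ∈ T` keeps at least the fraction `p` of it. -/
theorem mul_integral_le_integral_indicator {Ω Ω' β : Type*} [MeasurableSpace Ω]
    [MeasurableSpace Ω'] [MeasurableSpace β] {P : Measure Ω} [IsProbabilityMeasure P]
    {x : Ω → β} {ξ : Ω → Ω'} (hx : Measurable x) (hξ : Measurable ξ) (hind : IndepFun x ξ P)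
    {T : Set (β × Ω')} (hT : MeasurableSet T) {g : β → ℝ} (hg : Measurable g)
    (hg0 : ∀ a, 0 ≤ g a) (hint : Integrable (fun ω => g (x ω)) P) {p : ℝ}
    (hp : ∀ᵐ ω ∂P, p ≤ P.real {ω' | (x ω, ξ ω') ∈ T}) :
    p * ∫ ω, g (x ω) ∂P ≤ ∫ ω, T.indicator (fun z => g z.1) (x ω, ξ ω) ∂P := by
  have hpair := hx.prodMk hξ
  have hF : Measurable (T.indicator fun z : β × Ω' => g z.1) :=
    (hg.comp measurable_fst).indicator hT
  have hmap := (indepFun_iff_map_prod_eq_prod_map_map hx.aemeasurable hξ.aemeasurable).1 hind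
  have := Measure.isProbabilityMeasure_map (μ := P) hx.aemeasurable
  have := Measure.isProbabilityMeasure_map (μ := P) hξ.aemeasurable
  have hint' : Integrable g (P.map x) :=
    (integrable_map_measure hg.aestronglyMeasurable hx.aemeasurable).2 hint
  have hFint : Integrable (T.indicator fun z : β × Ω' => g z.1) ((P.map x).prod (P.map ξ)) :=
    (hint'.comp_fst _).indicator hT
  have hinner : ∀ a, ∫ b, T.indicator (fun z : β × Ω' => g z.1) (a, b) ∂(P.map ξ)
      = P.real {ω' | (a, ξ ω') ∈ T} * g a := by
    intro a
    have hTa : MeasurableSet (Prod.mk a ⁻¹' T) := measurable_prodMk_left hT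
    have e : (fun b => T.indicator (fun z : β × Ω' => g z.1) (a, b))
        = (Prod.mk a ⁻¹' T).indicator fun _ => g a := by
      ext b; rfl
    rw [e, integral_indicator_const _ hTa, map_measureReal_apply hξ hTa]
    rfl
  -- By independence the joint law is a product, so Fubini allows integrating over the noise with
  -- the state frozen.
  have e1 : ∫ ω, T.indicator (fun z => g z.1) (x ω, ξ ω) ∂P
      = ∫ a, P.real {ω' | (a, ξ ω') ∈ T} * g a ∂(P.map x) := by
    rw [← integral_map hpair.aemeasurable hF.aestronglyMeasurable, hmap,
      integral_prod _ hFint]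
    simp only [hinner]
  have hleft := hFint.integral_prod_left
  simp only [hinner] at hleft
  have hm : Measurable fun a => P.real {ω' | (a, ξ ω') ∈ T} := by
    have h1 : ∀ a, P.real {ω' | (a, ξ ω') ∈ T} = (P.map ξ).real (Prod.mk a ⁻¹' T) := fun a => by
      rw [map_measureReal_apply hξ (measurable_prodMk_left hT)]; rfl
    rw [funext h1]
    exact (measurable_measure_prodMk_left hT).ennreal_toReal
  have hmg : Measurable fun a => P.real {ω' | (a, ξ ω') ∈ T} * g a := hm.mul hg
  rw [e1, integral_map hx.aemeasurable hmg.aestronglyMeasurable, ← integral_const_mul]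
  refine integral_mono_ae (hint.const_mul p) ?_ ?_
  · exact (integrable_map_measure hmg.aestronglyMeasurable hx.aemeasurable).1 hleft
  · filter_upwards [hp] with ω hω
    exact mul_le_mul_of_nonneg_right hω (hg0 _)

theorem integrable_of_ae_bounded {Ω : Type*} [MeasurableSpace Ω] {P : Measure Ω}
    [IsFiniteMeasure P] {g : Ω → ℝ} (hg : Measurable g) (hg0 : ∀ ω, 0 ≤ g ω) {M : ℝ}
    (h : ∀ᵐ ω ∂P, g ω ≤ M) : Integrable g P :=
  Integrable.of_bound hg.aestronglyMeasurable M <| by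
    filter_upwards [h] with ω hω
    rwa [Real.norm_of_nonneg (hg0 ω)]

/-- Expected contraction of the disagreement in one averaging step. -/
theorem integral_disagreement_mix_le {m n : ℕ} {Ω Ω' : Type*} [MeasurableSpace Ω]
    [MeasurableSpace Ω'] {P : Measure Ω} [IsProbabilityMeasure P]
    {x : Ω → Fin m → EuclideanSpace ℝ (Fin n)} {ξ : Ω → Ω'} (hx : Measurable x)
    (hξ : Measurable ξ) (hind : IndepFun x ξ P)
    {ψ : (Fin m → EuclideanSpace ℝ (Fin n)) → Ω' → Matrix (Fin m) (Fin m) ℝ}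
    (hψ : ∀ i j, Measurable fun p : (Fin m → EuclideanSpace ℝ (Fin n)) × Ω' => ψ p.1 p.2 i j)
    {D : ℝ} (hD : ∀ᵐ ω ∂P, ∀ i j, ‖x ω i - x ω j‖ ≤ D)
    (hA : ∀ᵐ ω ∂P, ψ (x ω) (ξ ω) ∈ doublyStochastic ℝ (Fin m)) {γ : ℝ} (hγ : 0 < γ)
    (hdiag : ∀ᵐ ω ∂P, ∀ i, γ ≤ ψ (x ω) (ξ ω) i i) {G : Digraph (Fin m)} {p : ℝ} (hp0 : 0 ≤ p)
    (hp : ∀ i j, G.Adj j i → ∀ᵐ ω ∂P, p ≤ P.real {ω' | γ ≤ ψ (x ω) (ξ ω') i j}) {c : ℝ}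
    (hc0 : 0 < c) (hc : ∀ y : Fin m → EuclideanSpace ℝ (Fin n), disagreement y
      ≤ c * ∑ i, ∑ j, open Classical in if G.Adj j i then ‖y i - y j‖ ^ 2 else 0) :
    ∫ ω, disagreement (mix (ψ (x ω) (ξ ω)) (x ω)) ∂P
      ≤ (1 - m * γ ^ 2 / c * p) * ∫ ω, disagreement (x ω) ∂P := by
  classical
  have hxi : ∀ i, Measurable fun ω => x ω i := measurable_pi_iff.1 hx
  have hAij : ∀ i j, Measurable fun ω => ψ (x ω) (ξ ω) i j := fun i j =>
    (hψ i j).comp (hx.prodMk hξ)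
  have hV : Integrable (fun ω => disagreement (x ω)) P :=
    integrable_of_ae_bounded (measurable_disagreement.comp hx) (fun _ => disagreement_nonneg _)
      (M := m ^ 2 * D ^ 2) (by
        filter_upwards [hD] with ω hω using disagreement_le_of_dist_le hω)
  have hVmix : Integrable (fun ω => disagreement (mix (ψ (x ω) (ξ ω)) (x ω))) P :=
    integrable_of_ae_bounded (measurable_disagreement.comp (measurable_mix hψ hx hξ))
      (fun _ => disagreement_nonneg _) (M := m ^ 2 * D ^ 2) (by
        filter_upwards [hD, hA] with ω hω hω' using
          disagreement_le_of_dist_le (norm_mix_sub_mix_le hω' hω))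
  have hij : ∀ i j, Integrable (fun ω => ‖x ω i - x ω j‖ ^ 2) P := fun i j =>
    integrable_of_ae_bounded (by have := hxi i; have := hxi j; fun_prop) (fun _ => sq_nonneg _)
      (M := D ^ 2) (by
        filter_upwards [hD] with ω hω
        have := hω i j
        gcongr)
  let F : Fin m → Fin m → Ω → ℝ := fun i j ω =>
    if G.Adj j i ∧ γ ≤ ψ (x ω) (ξ ω) i j then ‖x ω i - x ω j‖ ^ 2 else 0
  have hF : ∀ i j, Integrable (F i j) P := by
    intro i j
    by_cases h : G.Adj j i
    · have e : F i j = {ω | γ ≤ ψ (x ω) (ξ ω) i j}.indicator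
          fun ω => ‖x ω i - x ω j‖ ^ 2 := by
        ext ω; simp [F, h, Set.indicator]
      rw [e]
      exact (hij i j).indicator (measurableSet_le measurable_const (hAij i j))
    · have e : F i j = fun _ => 0 := by ext ω; simp [F, h]
      rw [e]; exact integrable_zero _ _ _
  have hFlow : ∀ i j, p * ∫ ω, (if G.Adj j i then ‖x ω i - x ω j‖ ^ 2 else 0) ∂P
      ≤ ∫ ω, F i j ω ∂P := by
    intro i j
    by_cases h : G.Adj j i
    · have := mul_integral_le_integral_indicator hx hξ hind
        (T := {z | γ ≤ ψ z.1 z.2 i j}) (measurableSet_le measurable_const (hψ i j))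
        (g := fun y => ‖y i - y j‖ ^ 2) (by fun_prop) (fun _ => sq_nonneg _) (hij i j) (hp i j h)
      simpa [F, h, Set.indicator] using this
    · simp [F, h]
  have hsum : p * ∫ ω, disagreement (x ω) ∂P ≤ c * ∫ ω, ∑ i, ∑ j, F i j ω ∂P := by
    have hI : ∀ i j, Integrable
        (fun ω => if G.Adj j i then ‖x ω i - x ω j‖ ^ 2 else 0) P := by
      intro i j
      by_cases h : G.Adj j i
      · simpa [h] using hij i j
      · simp [h]
    have h1 : ∫ ω, disagreement (x ω) ∂P
        ≤ c * ∑ i, ∑ j, ∫ ω, (if G.Adj j i then ‖x ω i - x ω j‖ ^ 2 else 0) ∂P := by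
      have e : ∑ i, ∑ j, ∫ ω, (if G.Adj j i then ‖x ω i - x ω j‖ ^ 2 else 0) ∂P
          = ∫ ω, ∑ i, ∑ j, (if G.Adj j i then ‖x ω i - x ω j‖ ^ 2 else 0) ∂P := by
        rw [integral_finsetSum _ fun i _ => integrable_finsetSum _ fun j _ => hI i j]
        refine Finset.sum_congr rfl fun i _ => ?_
        rw [integral_finsetSum _ fun j _ => hI i j]
      rw [e, ← integral_const_mul]
      exact integral_mono hV ((integrable_finsetSum _ fun i _ =>
        integrable_finsetSum _ fun j _ => hI i j).const_mul c) fun ω => hc (x ω)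
    have h2 : ∫ ω, ∑ i, ∑ j, F i j ω ∂P = ∑ i, ∑ j, ∫ ω, F i j ω ∂P := by
      rw [integral_finsetSum _ fun i _ => integrable_finsetSum _ fun j _ => hF i j]
      refine Finset.sum_congr rfl fun i _ => ?_
      rw [integral_finsetSum _ fun j _ => hF i j]
    calc p * ∫ ω, disagreement (x ω) ∂P
        ≤ p * (c * ∑ i, ∑ j, ∫ ω, (if G.Adj j i then ‖x ω i - x ω j‖ ^ 2 else 0) ∂P) := by gcongr
      _ = c * ∑ i, ∑ j, p * ∫ ω, (if G.Adj j i then ‖x ω i - x ω j‖ ^ 2 else 0) ∂P := by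
          simp only [← Finset.mul_sum]; ring
      _ ≤ _ := by
          rw [h2]
          gcongr with i _ j _
          exact hFlow i j
  have hFint : Integrable (fun ω => ∑ i, ∑ j, F i j ω) P :=
    integrable_finsetSum _ fun i _ => integrable_finsetSum _ fun j _ => hF i j
  have hstep : ∫ ω, disagreement (mix (ψ (x ω) (ξ ω)) (x ω)) ∂P
      ≤ ∫ ω, (disagreement (x ω) - m * γ ^ 2 * ∑ i, ∑ j, F i j ω) ∂P := by
    refine integral_mono_ae hVmix (hV.sub (hFint.const_mul _)) ?_
    filter_upwards [hA, hdiag] with ω h1 h2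
    exact disagreement_mix_le h1 hγ h2 G (x ω)
  rw [integral_sub hV (hFint.const_mul _), integral_const_mul] at hstep
  refine hstep.trans ?_
  have h3 : m * γ ^ 2 / c * (p * ∫ ω, disagreement (x ω) ∂P)
      ≤ m * γ ^ 2 / c * (c * ∫ ω, ∑ i, ∑ j, F i j ω ∂P) := by gcongr
  have h4 : m * γ ^ 2 / c * (c * ∫ ω, ∑ i, ∑ j, F i j ω ∂P)
      = m * γ ^ 2 * ∫ ω, ∑ i, ∑ j, F i j ω ∂P := by field_simp
  linarith

theorem sq_integral_le_integral_sq_of_memLp {Ω : Type*} [MeasurableSpace Ω] {P : Measure Ω}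
    [IsProbabilityMeasure P] {g : Ω → ℝ} (hg : MemLp g 2 P) :
    (∫ ω, g ω ∂P) ^ 2 ≤ ∫ ω, g ω ^ 2 ∂P := by
  have h := variance_nonneg g P
  rw [variance_eq_sub hg] at h
  simpa using sub_nonneg.1 h

/-- Fatou's lemma. Taking the liminf in `ℝ≥0∞` avoids the default value that a real liminf takes on
badly unbounded sequences. -/
theorem ae_liminf_enorm_eq_zero {Ω E : Type*} [MeasurableSpace Ω] {P : Measure Ω}
    [NormedAddCommGroup E] [MeasurableSpace E] [BorelSpace E] {g : ℕ → Ω → E}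
    (hg : ∀ k, Measurable (g k)) (hint : ∀ k, Integrable (fun ω => ‖g k ω‖) P)
    (h : Tendsto (fun k => ∫ ω, ‖g k ω‖ ∂P) atTop (𝓝 0)) :
    ∀ᵐ ω ∂P, liminf (fun k => ‖g k ω‖ₑ) atTop = 0 := by
  have h1 : Tendsto (fun k => ∫⁻ ω, ‖g k ω‖ₑ ∂P) atTop (𝓝 0) := by
    have e : ∀ k, ∫⁻ ω, ‖g k ω‖ₑ ∂P = ENNReal.ofReal (∫ ω, ‖g k ω‖ ∂P) := fun k => by
      rw [ofReal_integral_eq_lintegral_ofReal (hint k) (ae_of_all _ fun _ => norm_nonneg _)]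
      simp only [ofReal_norm]
    simp only [e]
    rw [← ENNReal.ofReal_zero]
    exact (ENNReal.continuous_ofReal.tendsto 0).comp h
  have h2 : ∫⁻ ω, liminf (fun k => ‖g k ω‖ₑ) atTop ∂P = 0 := by
    refine le_antisymm ?_ zero_le
    exact (lintegral_liminf_le fun k => (hg k).enorm).trans_eq h1.liminf_eq
  exact (lintegral_eq_zero_iff (Measurable.liminf fun k => (hg k).enorm)).1 h2

/-! ### Estimates along the algorithm -/

section Algorithm

variable {m n : ℕ} {Ω Ω' : Type*}
  {X : Fin m → Set (EuclideanSpace ℝ (Fin n))} {X₀ : Set (EuclideanSpace ℝ (Fin n))}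
  {x₀ : Fin m → EuclideanSpace ℝ (Fin n)} {ξ : ℕ → Ω → Ω'}
  {ψ : (Fin m → EuclideanSpace ℝ (Fin n)) → Ω' → Matrix (Fin m) (Fin m) ℝ}
  {α : ℕ → ℝ} {d : ℕ → Ω → Fin m → EuclideanSpace ℝ (Fin n)} {L : ℝ}

theorem state_mem (hne : ∀ i, (X i).Nonempty) (hcl : ∀ i, IsClosed (X i))
    (hcv : ∀ i, Convex ℝ (X i)) (hx₀ : ∀ i, x₀ i ∈ X i) (k : ℕ) (ω : Ω) (i : Fin m) :
    state X ψ ξ α d x₀ k ω i ∈ X i := by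
  cases k with
  | zero => exact hx₀ i
  | succ k => exact (projOn_spec (hne i) (hcl i) (hcv i) _).1

/-- With identical constraint sets, the step taken after averaging has length at most `α(k) L`. -/
theorem norm_state_succ_sub_mix_le (hX : ∀ i, X i = X₀) (hcl : IsClosed X₀) (hcv : Convex ℝ X₀)
    (hx₀ : ∀ i, x₀ i ∈ X i) (hα : ∀ k, 0 < α k) (hd : ∀ k ω i, ‖d k ω i‖ ≤ L) {k : ℕ} {ω : Ω}
    (hA : commMatrix X ψ ξ α d x₀ k ω ∈ doublyStochastic ℝ (Fin m)) (i : Fin m) :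
    ‖state X ψ ξ α d x₀ (k + 1) ω i
      - mix (commMatrix X ψ ξ α d x₀ k ω) (state X ψ ξ α d x₀ k ω) i‖ ≤ α k * L := by
  have hmem : ∀ j, state X ψ ξ α d x₀ k ω j ∈ X₀ := fun j => by
    rw [← hX j]
    exact state_mem (fun i => ⟨_, hx₀ i⟩) (fun i => (hX i).symm ▸ hcl)
      (fun i => (hX i).symm ▸ hcv) hx₀ k ω j
  -- Identical sets enter here: the average `v` lies in `X₀`, so projection fixes it and cannot
  -- lengthen the step away from it.
  have hv := mix_mem_of_convex hA hcv hmem i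
  have h := norm_projOn_sub_le hcl hcv hv
    (mix (commMatrix X ψ ξ α d x₀ k ω) (state X ψ ξ α d x₀ k ω) i - α k • d k ω i)
  rw [sub_sub_cancel_left, norm_neg, norm_smul, Real.norm_of_nonneg (hα k).le] at h
  simp only [state, hX i]
  exact h.trans (mul_le_mul_of_nonneg_left (hd k ω i) (hα k).le)

/-- Averaging keeps the diameter bound, and two agents each move at most `α r * L` afterwards. -/
theorem norm_state_sub_state_le (hX : ∀ i, X i = X₀) (hcl : IsClosed X₀) (hcv : Convex ℝ X₀)
    (hx₀ : ∀ i, x₀ i ∈ X i) (hα : ∀ k, 0 < α k) (hd : ∀ k ω i, ‖d k ω i‖ ≤ L) {D₀ : ℝ}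
    (hD₀ : ∀ i j, ‖x₀ i - x₀ j‖ ≤ D₀) {ω : Ω}
    (hA : ∀ k, commMatrix X ψ ξ α d x₀ k ω ∈ doublyStochastic ℝ (Fin m)) (k : ℕ) (i j : Fin m) :
    ‖state X ψ ξ α d x₀ k ω i - state X ψ ξ α d x₀ k ω j‖
      ≤ D₀ + 2 * L * ∑ r ∈ Finset.range k, α r := by
  induction k generalizing i j with
  | zero => simpa [state] using hD₀ i j
  | succ k ih =>
    have h1 := norm_mix_sub_mix_le (hA k) ih i j
    have h2 := norm_state_succ_sub_mix_le hX hcl hcv hx₀ hα hd (hA k) i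
    have h3 := norm_state_succ_sub_mix_le hX hcl hcv hx₀ hα hd (hA k) j
    set v := mix (commMatrix X ψ ξ α d x₀ k ω) (state X ψ ξ α d x₀ k ω)
    set z := state X ψ ξ α d x₀ (k + 1) ω
    have e : z i - z j = (v i - v j) + ((z i - v i) - (z j - v j)) := by abel
    rw [e, Finset.sum_range_succ]
    have h4 := norm_add_le (v i - v j) ((z i - v i) - (z j - v j))
    have h5 := norm_sub_le (z i - v i) (z j - v j)
    linarith

/-- The expected disagreement tends to zero. -/
theorem tendsto_integral_disagreement [MeasurableSpace Ω] [MeasurableSpace Ω'] {P : Measure Ω}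
    [IsProbabilityMeasure P] (hm : 0 < m)
    (hX : ∀ i, X i = X₀) (hcl : IsClosed X₀) (hcv : Convex ℝ X₀) (hx₀ : ∀ i, x₀ i ∈ X i)
    (hξ : ∀ k, Measurable (ξ k)) (hindep : iIndepFun ξ P)
    (hψ : ∀ i j, Measurable fun p : (Fin m → EuclideanSpace ℝ (Fin n)) × Ω' => ψ p.1 p.2 i j)
    (hα : ∀ k, 0 < α k) (hαlim : LimitingStepsizes α)
    (hdmeas : ∀ k i, Measurable[history ξ k] fun ω => d k ω i)
    (hL : 0 ≤ L) (hd : ∀ k ω i, ‖d k ω i‖ ≤ L)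
    {G : Digraph (Fin m)} (hG : StronglyConn G)
    {γ δ K C : ℝ} (hγ : 0 < γ) (hδ : 0 < δ) (hδ1 : δ ≤ 1) (hK : 0 < K) (hC : 0 < C)
    (hcomm : CommunicationModel P ψ ξ G γ δ K C)
    (hds : ∀ᵐ ω ∂P, ∀ k, commMatrix X ψ ξ α d x₀ k ω ∈ doublyStochastic ℝ (Fin m))
    (hself : ∀ᵐ ω ∂P, ∀ k i, γ ≤ commMatrix X ψ ξ α d x₀ k ω i i) :
    Tendsto (fun k => ∫ ω, disagreement (state X ψ ξ α d x₀ k ω) ∂P) atTop (𝓝 0) := by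
  classical
  have hmeas' : ∀ k, Measurable[past ξ k] (state X ψ ξ α d x₀ k) :=
    measurable_state (fun i => ⟨_, hx₀ i⟩) (fun i => (hX i).symm ▸ hcl)
      (fun i => (hX i).symm ▸ hcv) hψ ξ α hdmeas x₀
  have hmeas : ∀ k, Measurable (state X ψ ξ α d x₀ k) := fun k =>
    (hmeas' k).mono (past_le hξ k) le_rfl
  -- growth of the distances and decay of the link probabilities
  obtain ⟨M, hM0, hM⟩ := hαlim.exists_le_div
  obtain ⟨D₀, hD₀⟩ : ∃ D₀ : ℝ, ∀ i j, ‖x₀ i - x₀ j‖ ≤ D₀ := by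
    obtain ⟨D₀, h⟩ := (Set.finite_range fun p : Fin m × Fin m => ‖x₀ p.1 - x₀ p.2‖).bddAbove
    exact ⟨D₀, fun i j => h ⟨(i, j), rfl⟩⟩
  have hs : 0 < 1 / (2 * C) := by positivity
  obtain ⟨B, hB0, hB⟩ := exists_rpow_bound_of_sum hM0 hM hs
  have hD : ∀ᵐ ω ∂P, ∀ k i j, ‖state X ψ ξ α d x₀ k ω i - state X ψ ξ α d x₀ k ω j‖
      ≤ (|D₀| + 2 * L * B + 1) * ((k : ℝ) + 1) ^ (1 / (2 * C)) := by
    filter_upwards [hds] with ω hω k i j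
    refine (norm_state_sub_state_le hX hcl hcv hx₀ hα hd hD₀ hω k i j).trans ?_
    have h1 : (1 : ℝ) ≤ ((k : ℝ) + 1) ^ (1 / (2 * C)) :=
      Real.one_le_rpow (by linarith [Nat.cast_nonneg (α := ℝ) k]) hs.le
    have h2 := mul_le_mul_of_nonneg_left (hB k) (show 0 ≤ 2 * L by positivity)
    nlinarith [le_abs_self D₀, mul_nonneg (abs_nonneg D₀) (sub_nonneg.2 h1)]
  obtain ⟨c, hc0, hc1, hc⟩ := exists_le_linkBound hδ hδ1 hK hC
    (B := |D₀| + 2 * L * B + 1) (by positivity)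
  -- contraction constants
  obtain ⟨a', ha0', ha'⟩ := hG.exists_disagreement_le n
  have hmγ : 0 < m * γ ^ 2 := by positivity
  -- The connectivity constant is enlarged to be positive and at least `m * γ ^ 2`, which forces `θ
  -- ≤ 1` and later `q k ≤ 1`.
  obtain ⟨a, ha0, haγ, ha⟩ : ∃ a : ℝ, 0 < a ∧ m * γ ^ 2 ≤ a ∧
      ∀ y : Fin m → EuclideanSpace ℝ (Fin n), disagreement y
        ≤ a * ∑ i, ∑ j, if G.Adj j i then ‖y i - y j‖ ^ 2 else 0 := by
    refine ⟨a' + m * γ ^ 2, by positivity, by linarith, fun y => (ha' y).trans ?_⟩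
    refine mul_le_mul_of_nonneg_right (by linarith) ?_
    exact Finset.sum_nonneg fun i _ => Finset.sum_nonneg fun j _ => by split_ifs <;> positivity
  set θ := m * γ ^ 2 / a with hθ
  have hθ0 : 0 < θ := by positivity
  have hθ1 : θ ≤ 1 := (div_le_one ha0).2 haγ
  have hsqrt : ∀ k : ℕ, 1 ≤ √((k : ℝ) + 1) := fun k => by
    rw [Real.one_le_sqrt]; linarith [Nat.cast_nonneg (α := ℝ) k]
  set q : ℕ → ℝ := fun k => θ * c / √((k : ℝ) + 1) with hq
  have hq0 : ∀ k, 0 < q k := fun k => by positivity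
  have hq1 : ∀ k, q k ≤ 1 := fun k =>
    (div_le_self (by positivity) (hsqrt k)).trans (mul_le_one₀ hθ1 hc0.le hc1)
  have hint : ∀ k, Integrable (fun ω => disagreement (state X ψ ξ α d x₀ k ω)) P := fun k =>
    integrable_of_ae_bounded (measurable_disagreement.comp (hmeas k))
      (fun _ => disagreement_nonneg _) (by
        filter_upwards [hD] with ω hω using disagreement_le_of_dist_le (hω k))
  have hmixint : ∀ k, Integrable (fun ω => disagreement
      (mix (commMatrix X ψ ξ α d x₀ k ω) (state X ψ ξ α d x₀ k ω))) P := fun k =>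
    integrable_of_ae_bounded (measurable_disagreement.comp (measurable_mix hψ (hmeas k) (hξ k)))
      (fun _ => disagreement_nonneg _) (by
        filter_upwards [hD, hds] with ω hω hω' using
          disagreement_le_of_dist_le (norm_mix_sub_mix_le (hω' k) (hω k)))
  have hmix : ∀ k, ∫ ω, disagreement
      (mix (commMatrix X ψ ξ α d x₀ k ω) (state X ψ ξ α d x₀ k ω)) ∂P
      ≤ (1 - q k) * ∫ ω, disagreement (state X ψ ξ α d x₀ k ω) ∂P := by
    intro k
    have h := integral_disagreement_mix_le (hmeas k) (hξ k)
      (indepFun_of_measurable_past hξ hindep (hmeas' k)) hψ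
      (by filter_upwards [hD] with ω hω using hω k) (by filter_upwards [hds] with ω hω using hω k)
      hγ (by filter_upwards [hself] with ω hω using hω k) (G := G)
      (p := c / √((k : ℝ) + 1)) (by positivity) (fun i j hij => by
        filter_upwards [hD] with ω hω
        exact (hc k _ (norm_nonneg _) (hω k i j)).trans (hcomm i j hij k _)) ha0 ha
    rwa [← hθ, ← mul_div_assoc] at h
  -- Young's parameter is `q k / 2`, since `(1 + q/2)(1 - q) ≤ 1 - q/2`. As `q ≤ 1`, `1 + 2/q ≤
  -- 3/q`, and `(3/q) * 4 = (q/2) * 24 / q²` explains the constant 24.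
  have hstep : ∀ k, ∫ ω, disagreement (state X ψ ξ α d x₀ (k + 1) ω) ∂P
      ≤ (1 - q k / 2) * ∫ ω, disagreement (state X ψ ξ α d x₀ k ω) ∂P
        + q k / 2 * (24 * m ^ 2 * L ^ 2 * (α k / q k) ^ 2) := by
    intro k
    have hη : 0 < q k / 2 := half_pos (hq0 k)
    have h1 : ∫ ω, disagreement (state X ψ ξ α d x₀ (k + 1) ω) ∂P
        ≤ ∫ ω, ((1 + q k / 2) * disagreement
          (mix (commMatrix X ψ ξ α d x₀ k ω) (state X ψ ξ α d x₀ k ω))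
          + (1 + (q k / 2)⁻¹) * (4 * m ^ 2 * (α k * L) ^ 2)) ∂P := by
      refine integral_mono_ae (hint _) (((hmixint k).const_mul _).add (integrable_const _)) ?_
      filter_upwards [hds] with ω hω
      exact disagreement_perturb_le hη
        (norm_state_succ_sub_mix_le hX hcl hcv hx₀ hα hd (hω k))
    rw [integral_add ((hmixint k).const_mul _) (integrable_const _), integral_const_mul,
      integral_const, probReal_univ, one_smul] at h1
    have hU : 0 ≤ ∫ ω, disagreement (state X ψ ξ α d x₀ k ω) ∂P :=
      integral_nonneg fun _ => disagreement_nonneg _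
    have h2 : (1 + q k / 2) * ∫ ω, disagreement
        (mix (commMatrix X ψ ξ α d x₀ k ω) (state X ψ ξ α d x₀ k ω)) ∂P
        ≤ (1 - q k / 2) * ∫ ω, disagreement (state X ψ ξ α d x₀ k ω) ∂P := by
      refine (mul_le_mul_of_nonneg_left (hmix k) (by positivity)).trans ?_
      rw [← mul_assoc]
      refine mul_le_mul_of_nonneg_right ?_ hU
      nlinarith [sq_nonneg (q k)]
    have h3 : (1 + (q k / 2)⁻¹) * (4 * m ^ 2 * (α k * L) ^ 2)
        ≤ q k / 2 * (24 * m ^ 2 * L ^ 2 * (α k / q k) ^ 2) := by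
      have e : q k / 2 * (24 * m ^ 2 * L ^ 2 * (α k / q k) ^ 2)
          = (3 / q k) * (4 * m ^ 2 * (α k * L) ^ 2) := by
        have := (hq0 k).ne'
        field_simp; ring
      rw [e]
      refine mul_le_mul_of_nonneg_right ?_ (by positivity)
      have : 1 ≤ 1 / q k := by rw [le_div_iff₀ (hq0 k), one_mul]; exact hq1 k
      have e2 : (q k / 2)⁻¹ = 2 * (1 / q k) := by rw [inv_div]; ring
      have e3 : 3 / q k = 3 * (1 / q k) := by ring
      rw [e2, e3]; linarith
    linarith
  -- The ratio is at most `M / (θ * c * √(k + 1))`: the stepsize decays like `1/k`, the rate only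
  -- like `1/√k`.
  have hratio : Tendsto (fun k => α k / q k) atTop (𝓝 0) := by
    have h1 : Tendsto (fun k : ℕ => √((k : ℝ) + 1)) atTop atTop :=
      Real.tendsto_sqrt_atTop.comp
        (tendsto_atTop_add_const_right atTop 1 tendsto_natCast_atTop_atTop)
    refine squeeze_zero (fun k => div_nonneg (hα k).le (hq0 k).le) (fun k => ?_)
      (h1.const_div_atTop (M / (θ * c)))
    have hp : 0 < √((k : ℝ) + 1) := lt_of_lt_of_le one_pos (hsqrt k)
    have hsq : √((k : ℝ) + 1) * √((k : ℝ) + 1) = (k : ℝ) + 1 :=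
      Real.mul_self_sqrt (by positivity)
    have e : M / (θ * c) / √((k : ℝ) + 1) = M / ((k : ℝ) + 1) / q k := by
      simp only [hq]
      generalize √((k : ℝ) + 1) = t at hp hsq
      rw [← hsq]
      field_simp
    rw [e]
    have := hq0 k
    gcongr
    exact hM k
  refine tendsto_zero_of_perturbed_contraction
    (fun k => integral_nonneg fun _ => disagreement_nonneg _)
    (fun k => by linarith [hq1 k, hq0 k]) (fun k => (half_pos (hq0 k)).le) ?_ ?_ hstep
  · refine (tendsto_sum_const_div_sqrt (half_pos (mul_pos hθ0 hc0))).congr fun k =>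
      Finset.sum_congr rfl fun r _ => ?_
    simp only [hq]; ring
  · simpa using (hratio.pow 2).const_mul (24 * (m : ℝ) ^ 2 * L ^ 2)

end Algorithm

end DistSubgrad

theorem mainTheorem8 {m n : ℕ} {Ω Ω' : Type*} [MeasurableSpace Ω] [MeasurableSpace Ω']
    (P : Measure Ω) [IsProbabilityMeasure P]
    -- convex objectives with bounded subgradients
    (f : Fin m → EuclideanSpace ℝ (Fin n) → ℝ)
    (hf : ∀ i, ConvexOn ℝ Set.univ (f i))
    (hL : DistSubgrad.BoundedSubgradients f)
    -- identical closed convex constraint sets, feasible initial estimates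
    (X : Fin m → Set (EuclideanSpace ℝ (Fin n)))
    (X₀ : Set (EuclideanSpace ℝ (Fin n))) (hX : ∀ i, X i = X₀)
    (hXcl : IsClosed X₀) (hXcv : Convex ℝ X₀)
    (x₀ : Fin m → EuclideanSpace ℝ (Fin n)) (hx₀ : ∀ i, x₀ i ∈ X i)
    -- Markovian communication model driven by independent noise
    (ξ : ℕ → Ω → Ω') (hξ : ∀ k, Measurable (ξ k)) (hindep : iIndepFun ξ P)
    (ψ : (Fin m → EuclideanSpace ℝ (Fin n)) → Ω' → Matrix (Fin m) (Fin m) ℝ)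
    (hψ : ∀ i j, Measurable fun p : (Fin m → EuclideanSpace ℝ (Fin n)) × Ω' => ψ p.1 p.2 i j)
    -- positive stepsizes
    (α : ℕ → ℝ) (hα : ∀ k, 0 < α k) (hαlim : DistSubgrad.LimitingStepsizes α)
    -- `d_i(k)` is a nonanticipating choice of a subgradient of `f_i` at `v_i(k)`
    (d : ℕ → Ω → Fin m → EuclideanSpace ℝ (Fin n))
    (hdmeas : ∀ k i, Measurable[DistSubgrad.history ξ k] fun ω => d k ω i)
    (hd : ∀ k ω i, DistSubgrad.IsSubgradientAt (f i)
      (DistSubgrad.mix (DistSubgrad.commMatrix X ψ ξ α d x₀ k ω)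
        (DistSubgrad.state X ψ ξ α d x₀ k ω) i) (d k ω i))
    -- strongly connected backbone and link probabilities
    (G : Digraph (Fin m)) (hG : DistSubgrad.StronglyConn G)
    (γ δ K C : ℝ) (hγ : 0 < γ) (hδ : 0 < δ) (hδ1 : δ ≤ 1) (hK : 0 < K) (hC : 0 < C)
    (hcomm : DistSubgrad.CommunicationModel P ψ ξ G γ δ K C)
    -- doubly stochastic weights and self confidence
    (hds : ∀ᵐ ω ∂P, ∀ k,
      DistSubgrad.commMatrix X ψ ξ α d x₀ k ω ∈ doublyStochastic ℝ (Fin m))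
    (hself : ∀ᵐ ω ∂P, ∀ k i, γ ≤ DistSubgrad.commMatrix X ψ ξ α d x₀ k ω i i) :
    ∀ i : Fin m,
      (∀ k, Integrable (fun ω => ‖DistSubgrad.state X ψ ξ α d x₀ k ω i
        - DistSubgrad.average (DistSubgrad.state X ψ ξ α d x₀ k ω)‖) P) ∧
      Tendsto (fun k => ∫ ω, ‖DistSubgrad.state X ψ ξ α d x₀ k ω i
        - DistSubgrad.average (DistSubgrad.state X ψ ξ α d x₀ k ω)‖ ∂P) atTop (𝓝 0) ∧
      ∀ᵐ ω ∂P, liminf (fun k => ‖DistSubgrad.state X ψ ξ α d x₀ k ω i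
        - DistSubgrad.average (DistSubgrad.state X ψ ξ α d x₀ k ω)‖ₑ) atTop = 0 := by
  intro i
  obtain ⟨L, hL0, hLb⟩ := hL
  have hdL : ∀ k ω i, ‖d k ω i‖ ≤ L := fun k ω i => hLb i _ _ (hd k ω i)
  have hV := DistSubgrad.tendsto_integral_disagreement i.pos hX hXcl hXcv hx₀ hξ hindep hψ hα
    hαlim hdmeas hL0.le hdL hG hγ hδ hδ1 hK hC hcomm hds hself
  set x := DistSubgrad.state X ψ ξ α d x₀
  have hmeas : ∀ k, Measurable (x k) := fun k =>
    (DistSubgrad.measurable_state (fun i => ⟨_, hx₀ i⟩) (fun i => (hX i).symm ▸ hXcl)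
      (fun i => (hX i).symm ▸ hXcv) hψ ξ α hdmeas x₀ k).mono (DistSubgrad.past_le hξ k) le_rfl
  have hgmeas : ∀ k, Measurable fun ω => x k ω i - DistSubgrad.average (x k ω) := fun k => by
    have := measurable_pi_iff.1 (hmeas k)
    unfold DistSubgrad.average
    fun_prop
  obtain ⟨D₀, hD₀⟩ : ∃ D₀ : ℝ, ∀ i j, ‖x₀ i - x₀ j‖ ≤ D₀ := by
    obtain ⟨D₀, h⟩ := (Set.finite_range fun p : Fin m × Fin m => ‖x₀ p.1 - x₀ p.2‖).bddAbove
    exact ⟨D₀, fun i j => h ⟨(i, j), rfl⟩⟩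
  have hVb : ∀ k, ∃ B : ℝ, ∀ᵐ ω ∂P, DistSubgrad.disagreement (x k ω) ≤ B := fun k => ⟨_, by
    filter_upwards [hds] with ω hω using DistSubgrad.disagreement_le_of_dist_le
      (DistSubgrad.norm_state_sub_state_le hX hXcl hXcv hx₀ hα hdL hD₀ hω k)⟩
  have hmem : ∀ k, MemLp (fun ω => ‖x k ω i - DistSubgrad.average (x k ω)‖) 2 P := fun k => by
    obtain ⟨B, hB⟩ := hVb k
    refine MemLp.of_bound (hgmeas k).norm.aestronglyMeasurable √B ?_
    filter_upwards [hB] with ω hω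
    rw [norm_norm]
    exact Real.le_sqrt_of_sq_le ((DistSubgrad.norm_sub_average_sq_le _ i).trans hω)
  have hint : ∀ k, Integrable (fun ω => ‖x k ω i - DistSubgrad.average (x k ω)‖) P := fun k =>
    (hmem k).integrable (by norm_num)
  have hlim : Tendsto (fun k => ∫ ω, ‖x k ω i - DistSubgrad.average (x k ω)‖ ∂P) atTop
      (𝓝 0) := by
    have hsqrt : Tendsto (fun k => √(∫ ω, DistSubgrad.disagreement (x k ω) ∂P)) atTop (𝓝 0) := by
      simpa using hV.sqrt
    refine squeeze_zero (fun k => integral_nonneg fun _ => norm_nonneg _) (fun k => ?_) hsqrt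
    -- Jensen: the squared mean distance is at most the mean square, which the expected disagreement
    -- dominates.
    refine Real.le_sqrt_of_sq_le
      ((DistSubgrad.sq_integral_le_integral_sq_of_memLp (hmem k)).trans ?_)
    obtain ⟨B, hB⟩ := hVb k
    exact integral_mono (hmem k).integrable_sq
      (DistSubgrad.integrable_of_ae_bounded (DistSubgrad.measurable_disagreement.comp (hmeas k))
        (fun _ => DistSubgrad.disagreement_nonneg _) hB)
      fun ω => DistSubgrad.norm_sub_average_sq_le _ i
  exact ⟨hint, hlim, DistSubgrad.ae_liminf_enorm_eq_zero hgmeas hint hlim⟩
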